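/- Consider a vacuum plane wave in Brinkmann coordinates: an open connected region of $(u,v,\zeta,\bar\zeta)$-space, $\zeta=(x+iy)/\sqrt2$, with the metric $$ds^2=-2\,du\,dv-2H\,du^2+2\,d\zeta\,d\bar\zeta,\qquad H=\mathrm{Re}\,(A(u)\zeta^2),$$ where $A$ is a smooth, nowhere vanishing complex function. A canonical coframe is a smooth complex null tetrad $\{\ell,n,m,\bar m\}$ ($\langle\ell,n\rangle=-1$, $\langle m,\bar m\rangle=1$, all other products $0$) with $\ell$ a positive multiple of the covariantly constant vector $\partial_v$, with $(\mathrm{Re}\,m,\mathrm{Im}\,m)$ oriented as $(\partial_x,\partial_y)$, and with $\Psi_4=C_{abcd}n^a\bar m^bn^c\bar m^d=1$; $\gamma_c=\tfrac12\left(\langle\nabla_nn,\ell\rangle-\langle\nabla_n\bar m,m\rangle\right)$ is its Newman–Penrose spin coefficient. Suppose that $\bar\gamma_c=-\gamma_c$ for some canonical coframe. Then there is a change of coordinates to Brinkmann coordinates of the same kind (again denoted $u,v,\zeta,\bar\zeta$), and a smooth real function $g$ with antiderivative $G=\int g\,du$, such that $\gamma_c=ig(u)$ in every canonical coframe and $$A(u)=e^{4\int\gamma_c\,du}=e^{4iG(u)}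 .$$ In these coordinates let $x(\tau)$ be any timelike geodesic with proper time $\tau$, and let $\Psi_4$ along it be taken relative to the interpretation tetrad $$\ell=\frac{1}{\sqrt2\,\dot u}\partial_v,\qquad n=\sqrt2\,\dot x-\ell,\qquad m=-\partial_{\bar\zeta}-\frac{\dot\zeta}{\dot u}\,\partial_v ,$$ which is a complex null tetrad with $\dot x=(\ell+n)/\sqrt2$. Then $\dot u\ne0$ and: 1. $|\Psi_4|/\dot u^2=2$; equivalently, relative to the tetrad after the constant boost $\ell\mapsto\sqrt2\,\ell$, $n\mapsto n/\sqrt2$, one has $|\Psi_4|/\dot u^2=1$. 2. Let $A_+=\frac14(\Psi_4+\bar\Psi_4)$ and $A_\times=\frac i4(\bar\Psi_4-\Psi_4)$. Wherever $A_+\neq0$, the polarization phase $P=\frac12\arctan(A_\times/A_+)$ equals $\frac12\arctan\tan(4G(u(\tau)))$ and $\dot P=2g(u(\tau))\,\dot u$. Along the whole geodesic, $2G(u(\tau))$ is a continuous determination of the phase (a continuous $P$ with $A_\times\cos 2P=A_+\sin 2P$), and every continuous determination satisfies $$P(\tau)-P(\tau_0)=\int_{\tau_0}^{\tau}-2i\,\gamma_c\,\dot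 u\,d\tau=2\int_{\tau_0}^{\tau}g(u(\tau))\,\dot u\,d\tau .$$ -/

import Mathlib

open scoped ContDiff ComplexConjugate

noncomputable section

namespace PlaneWaves

/-! ### Pseudo-Riemannian geometry in a coordinate chart of dimension four -/

/-- Points of a coordinate chart. For plane waves the coordinates are `(u, v, x, y)`,
with indices `0, 1, 2, 3`. -/
abbrev Pt : Type := Fin 4 → ℝ

/-- A field of metric coefficients `g_{ab}`. -/
abbrev MetricField : Type := Pt → Matrix (Fin 4) (Fin 4) ℝ

/-- The partial derivative `∂f/∂x^i` at `p`. -/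
def pd {F : Type*} [NormedAddCommGroup F] [NormedSpace ℝ F]
    (i : Fin 4) (f : Pt → F) (p : Pt) : F :=
  fderiv ℝ f p (Pi.single i 1)

/-- The Christoffel symbols `Γ^a_{bc}` of the Levi-Civita connection. -/
def christoffel (g : MetricField) (p : Pt) (a b c : Fin 4) : ℝ :=
  (1 / 2) * ∑ d, (g p)⁻¹ a d *
    (pd b (fun q => g q d c) p + pd c (fun q => g q d b) p - pd d (fun q => g q b c) p)

/-- The Riemann tensor
`R^a_{bcd} = ∂_c Γ^a_{db} - ∂_d Γ^a_{cb} + Γ^a_{ce} Γ^e_{db} - Γ^a_{de} Γ^e_{cb}`. -/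
def riemannUp (g : MetricField) (p : Pt) (a b c d : Fin 4) : ℝ :=
  pd c (fun q => christoffel g q a d b) p - pd d (fun q => christoffel g q a c b) p
    + ∑ e, (christoffel g p a c e * christoffel g p e d b
        - christoffel g p a d e * christoffel g p e c b)

/-- The Riemann tensor `R_{abcd}` with all indices lowered. -/
def riemann (g : MetricField) (p : Pt) (a b c d : Fin 4) : ℝ :=
  ∑ e, g p a e * riemannUp g p e b c d

/-- The Ricci tensor `R_{bd} = R^a_{bad}`. -/
def ricci (g : MetricField) (p : Pt) (b d : Fin 4) : ℝ :=
  ∑ a, riemannUp g p a b a d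

/-- The scalar curvature. -/
def scalarCurv (g : MetricField) (p : Pt) : ℝ :=
  ∑ b, ∑ d, (g p)⁻¹ b d * ricci g p b d

/-- The Weyl tensor `C_{abcd}` in dimension four. -/
def weyl (g : MetricField) (p : Pt) (a b c d : Fin 4) : ℝ :=
  riemann g p a b c d
    - (1 / 2) * (g p a c * ricci g p b d - g p a d * ricci g p b c
        - g p b c * ricci g p a d + g p b d * ricci g p a c)
    + (scalarCurv g p / 6) * (g p a c * g p b d - g p a d * g p b c)

/-- The metric at `p`, extended complex-bilinearly to complex vectors. -/
def ip (g : MetricField) (p : Pt) (X Y : Fin 4 → ℂ) : ℂ :=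
  ∑ a, ∑ b, (g p a b : ℂ) * X a * Y b

/-- The metric at `p` on real vectors. -/
def rip (g : MetricField) (p : Pt) (X Y : Fin 4 → ℝ) : ℝ :=
  ∑ a, ∑ b, g p a b * X a * Y b

/-- A real vector regarded as a complex one. -/
def cvec (X : Fin 4 → ℝ) : Fin 4 → ℂ := fun a => (X a : ℂ)

/-- The complex conjugate vector. -/
def conjVec (X : Fin 4 → ℂ) : Fin 4 → ℂ := fun a => conj (X a)

/-- The covariant derivative `∇_V X` at `p` of a complex vector field `X`. -/
def nabla (g : MetricField) (V : Fin 4 → ℂ) (X : Pt → Fin 4 → ℂ) (p : Pt) : Fin 4 → ℂ :=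
  fun a => ∑ b, V b * (pd b (fun q => X q a) p + ∑ c, (christoffel g p a b c : ℂ) * X p c)

/-- `Φ` is a smooth diffeomorphism of `U` onto `U'` that pulls the metric `g'` back to `g`:
a change of coordinates that turns the metric `g` on `U` into `g'` on `U'`. -/
def IsCoordChange (g : MetricField) (U : Set Pt) (g' : MetricField) (U' : Set Pt)
    (Φ : Pt → Pt) : Prop :=
  ContDiffOn ℝ ∞ Φ U ∧ Set.MapsTo Φ U U' ∧
  (∃ Φi : Pt → Pt, ContDiffOn ℝ ∞ Φi U' ∧ Set.MapsTo Φi U' U ∧ Set.InvOn Φi Φ U U') ∧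
  ∀ p ∈ U, ∀ X Y : Fin 4 → ℝ,
    rip g' (Φ p) (fderiv ℝ Φ p X) (fderiv ℝ Φ p Y) = rip g p X Y

/-- A curve `x`, parametrized on `J` by proper time, that is a timelike geodesic of `g` in `U`. -/
def IsTimelikeGeodesic (g : MetricField) (U : Set Pt) (x : ℝ → Pt) (J : Set ℝ) : Prop :=
  ContDiffOn ℝ 2 x J ∧ (∀ τ ∈ J, x τ ∈ U) ∧
  (∀ τ ∈ J, rip g (x τ) (deriv x τ) (deriv x τ) = -1) ∧
  ∀ τ ∈ J, ∀ a, deriv (deriv x) τ a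
    + ∑ b, ∑ c, christoffel g (x τ) a b c * deriv x τ b * deriv x τ c = 0

/-! ### Complex null tetrads -/

/-- The vectors `ℓ, n` (real) and `m` (complex) of a tetrad `{ℓ, n, m, m̄}` at a point. -/
structure Tetrad where
  l : Fin 4 → ℝ
  n : Fin 4 → ℝ
  m : Fin 4 → ℂ

/-- A complex null tetrad in signature `(-,+,+,+)`: the only nonzero products are
`⟨ℓ, n⟩ = -1` and `⟨m, m̄⟩ = 1`. -/
def IsNullTetrad (g : MetricField) (p : Pt) (E : Tetrad) : Prop :=
  rip g p E.l E.l = 0 ∧ rip g p E.n E.n = 0 ∧ rip g p E.l E.n = -1 ∧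
  ip g p E.m E.m = 0 ∧ ip g p E.m (conjVec E.m) = 1 ∧
  ip g p (cvec E.l) E.m = 0 ∧ ip g p (cvec E.n) E.m = 0

/-- The boost `ℓ ↦ κ ℓ`, `n ↦ κ⁻¹ n`, `m ↦ m`. -/
def Tetrad.boost (E : Tetrad) (κ : ℝ) : Tetrad where
  l := fun a => κ * E.l a
  n := fun a => κ⁻¹ * E.n a
  m := E.m

/-- The Weyl scalar `Ψ₄ = C_{abcd} n^a m̄^b n^c m̄^d`. -/
def Psi4 (g : MetricField) (p : Pt) (E : Tetrad) : ℂ :=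
  ∑ a, ∑ b, ∑ c, ∑ d, (weyl g p a b c d : ℂ)
    * (E.n a : ℂ) * conj (E.m b) * (E.n c : ℂ) * conj (E.m d)

/-- The Newman–Penrose spin coefficient
`γ = ½ (⟨∇_n n, ℓ⟩ - ⟨∇_n m̄, m⟩)` of a tetrad field, in signature `(-,+,+,+)`. -/
def spinGamma (g : MetricField) (T : Pt → Tetrad) (p : Pt) : ℂ :=
  (1 / 2) * (ip g p (nabla g (cvec (T p).n) (fun q => cvec (T q).n) p) (cvec (T p).l)
    - ip g p (nabla g (cvec (T p).n) (fun q => conjVec (T q).m) p) (T p).m)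

/-! ### Vacuum plane waves in Brinkmann coordinates -/

/-- The complex transverse coordinate `ζ = (x + i y) / √2`. -/
def zeta (p : Pt) : ℂ := ((p 2 : ℂ) + (p 3 : ℂ) * Complex.I) / (Real.sqrt 2 : ℂ)

/-- `H = Re f` with `f(ζ, u) = A(u) ζ²`. -/
def profileH (A : ℝ → ℂ) (p : Pt) : ℝ := (A (p 0) * zeta p ^ 2).re

/-- The metric `-2 du dv - 2 H du² + 2 dζ dζ̄`, where `2 dζ dζ̄ = dx² + dy²`. -/
def brinkmann (A : ℝ → ℂ) : MetricField := fun p =>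
  !![-2 * profileH A p, -1, 0, 0;
     -1, 0, 0, 0;
     0, 0, 1, 0;
     0, 0, 0, 1]

/-- A (nowhere flat, that is Petrov type N) vacuum plane wave: an open connected region of
Brinkmann coordinates with a metric of the form `f = A(u) ζ²`. -/
structure PlaneWave where
  U : Set Pt
  isOpen : IsOpen U
  connected : IsConnected U
  A : ℝ → ℂ
  smooth : ContDiffOn ℝ ∞ A ((fun p : Pt => p 0) '' U)
  ne_zero : ∀ u ∈ (fun p : Pt => p 0) '' U, A u ≠ 0

/-- The range of the coordinate `u`. -/
def PlaneWave.uRange (M : PlaneWave) : Set ℝ := (fun p : Pt => p 0) '' M.U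

/-- The metric of a plane wave. -/
def PlaneWave.g (M : PlaneWave) : MetricField := brinkmann M.A

/-- The canonical coframes: smooth complex null tetrads with `ℓ` a positive multiple of the
covariantly constant null vector `∂_v`, with `m = (e₂ + i e₃) / √2` oriented as
`(∂_x + i ∂_y) / √2`, and with `Ψ₄ = 1`. -/
def PlaneWave.IsCanonical (M : PlaneWave) (T : Pt → Tetrad) : Prop :=
  ContDiffOn ℝ ∞ (fun p => (T p).l) M.U ∧ ContDiffOn ℝ ∞ (fun p => (T p).n) M.U ∧
  ContDiffOn ℝ ∞ (fun p => (T p).m) M.U ∧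
  ∀ p ∈ M.U, IsNullTetrad M.g p (T p) ∧
    (∃ b : ℝ, 0 < b ∧ (T p).l = Pi.single 1 b) ∧
    0 < (conj ((T p).m 2) * (T p).m 3).im ∧
    Psi4 M.g p (T p) = 1

/-- The interpretation tetrad of an observer with four-velocity `w = (u̇, v̇, ẋ, ẏ)`:
`ℓ = (√2 u̇)⁻¹ ∂_v`, `n = √2 w - ℓ`, `m = -∂_ζ̄ - (ζ̇ / u̇) ∂_v`,
where `∂_ζ̄ = (∂_x + i ∂_y) / √2`. Then `w = (ℓ + n) / √2` and `⟨ℓ, w⟩ = -1 / √2`. -/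
def interpTetrad (w : Fin 4 → ℝ) : Tetrad where
  l := Pi.single 1 (1 / (Real.sqrt 2 * w 0))
  n := fun a => Real.sqrt 2 * w a
    - (Pi.single 1 (1 / (Real.sqrt 2 * w 0)) : Fin 4 → ℝ) a
  m := ![0, -(zeta w / (w 0 : ℂ)), -(1 / (Real.sqrt 2 : ℂ)),
    -(Complex.I / (Real.sqrt 2 : ℂ))]

/-- `Ψ₄` relative to the interpretation tetrad along the curve `x`. -/
def PlaneWave.psi4Along (M : PlaneWave) (x : ℝ → Pt) (τ : ℝ) : ℂ :=
  Psi4 M.g (x τ) (interpTetrad (deriv x τ))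

/-! ### Polarization -/

/-- The amplitude `A₊ = ¼ (Ψ₄ + Ψ̄₄)`. -/
def ampPlus (Ψ : ℂ) : ℝ := ((1 / 4) * (Ψ + conj Ψ)).re

/-- The amplitude `A_× = (i/4) (Ψ̄₄ - Ψ₄)`. -/
def ampCross (Ψ : ℂ) : ℝ := ((Complex.I / 4) * (conj Ψ - Ψ)).re

/-- The polarization phase `P = ½ arctan (A_× / A₊)`, for `A₊ ≠ 0`. -/
def polPhase (Ψ : ℂ) : ℝ := (1 / 2) * Real.arctan (ampCross Ψ / ampPlus Ψ)

/-- A continuous determination on `J` of the polarization phase, `tan (2 P) = A_× / A₊`, written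
without the quotient so that it continues through the zeros of `A₊`. -/
def IsPolPhaseOn (Ψ : ℝ → ℂ) (J : Set ℝ) (P : ℝ → ℝ) : Prop :=
  ContinuousOn P J ∧
  ∀ τ ∈ J, ampCross (Ψ τ) * Real.cos (2 * P τ) = ampPlus (Ψ τ) * Real.sin (2 * P τ)

end PlaneWaves

end

open PlaneWaves
open scoped ContDiff ComplexConjugate

open scoped ContDiff ComplexConjugate

noncomputable section

namespace PlaneWaves

/-! ### Curvature of the Brinkmann metric -/

/-! The canonical conditions determine the tetrad up to choices that do not affect γ. With ν = n⁰ >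
0 and μ the conjugate of m², nullity gives 2|μ|² = 1, and Ψ₄ = 1 reads 2(νμ)²A = 1
(`Psi4_brinkmann`, `IsNullTetrad.components`). Hence ν = |A|^(-1/2), and the logarithmic derivative
of νμ is that of A^(-1/2). No connection term survives in γ = -½ n(log(νμ)), so γ = A'/(4A√|A|)
(`PlaneWave.IsCanonical.spinGamma_eq`).

Thus γ is imaginary exactly when Re(ĀA') = 0, that is, when |A| is constant
(`PlaneWave.IsCanonical.norm_eq`). The scaling (u, v) ↦ (ku, v/k) divides A by k², so k = √|A| makes
|A| = 1. Integrating A'/(4A) = ig then gives A = exp(4iG) and γ = ig (`PlaneWave.exists_phase`).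

For an observer, Ψ₄ = 2u̇²A(u) (`Psi4_interpTetrad`): its modulus is 2u̇², and (A₊, A_×) is u̇²(cos
4G, sin 4G). Any phase P therefore differs from 2G by a multiple of π/2, which continuity makes
constant (`sub_eq_sub_of_sin_eq_zero`); the integral formula is the fundamental theorem of calculus
for G(u(τ)). -/

lemma hasFDerivAt_coord (i : Fin 4) (p : Pt) :
    HasFDerivAt (fun q : Pt => q i) (ContinuousLinearMap.proj (R := ℝ) (φ := fun _ => ℝ) i) p :=
  hasFDerivAt_apply i p

lemma pd_eq {F : Type*} [NormedAddCommGroup F] [NormedSpace ℝ F] {f : Pt → F} {p : Pt}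
    {f' : Pt →L[ℝ] F} (h : HasFDerivAt f f' p) (i : Fin 4) : pd i f p = f' (Pi.single i 1) := by
  rw [pd, h.fderiv]

@[simp] lemma pd_const {F : Type*} [NormedAddCommGroup F] [NormedSpace ℝ F] (c : F) (p : Pt)
    (i : Fin 4) : pd i (fun _ => c) p = 0 := by
  simp [pd]

lemma pd_congr {F : Type*} [NormedAddCommGroup F] [NormedSpace ℝ F] {f h : Pt → F} {p : Pt}
    (H : f =ᶠ[nhds p] h) (i : Fin 4) : pd i f p = pd i h p := by
  rw [pd, pd, H.fderiv_eq]

lemma sqrt_two_sq : ((Real.sqrt 2 : ℝ) : ℂ) ^ 2 = 2 := by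
  rw [← Complex.ofReal_pow, Real.sq_sqrt (by norm_num)]; norm_num

lemma profileH_eq (A : ℝ → ℂ) (p : Pt) :
    profileH A p = (1 / 2) * ((A (p 0)).re * (p 2 ^ 2 - p 3 ^ 2))
      - (A (p 0)).im * (p 2 * p 3) := by
  have : A (p 0) * zeta p ^ 2 = A (p 0) * ((p 2 : ℂ) + (p 3 : ℂ) * Complex.I) ^ 2 * (1 / 2 : ℝ) := by
    rw [zeta, div_pow, sqrt_two_sq]; push_cast; ring
  rw [profileH, this, Complex.re_mul_ofReal, Complex.mul_re]
  simp [pow_two, Complex.add_re, Complex.add_im, Complex.mul_re, Complex.mul_im]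
  ring

/-- The partial derivatives of `H`, when `A` has derivative `A'` at `u`. -/
def dH (A : ℝ → ℂ) (A' : ℝ → ℂ) (p : Pt) : Fin 4 → ℝ :=
  ![(1 / 2) * ((A' (p 0)).re * (p 2 ^ 2 - p 3 ^ 2)) - (A' (p 0)).im * (p 2 * p 3), 0,
    (A (p 0)).re * p 2 - (A (p 0)).im * p 3, -((A (p 0)).re * p 3) - (A (p 0)).im * p 2]

lemma hasDerivAt_re {A : ℝ → ℂ} {a : ℂ} {u : ℝ} (h : HasDerivAt A a u) :
    HasDerivAt (fun s => (A s).re) a.re u :=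
  (Complex.reCLM.hasFDerivAt.comp_hasDerivAt u h)

lemma hasDerivAt_im {A : ℝ → ℂ} {a : ℂ} {u : ℝ} (h : HasDerivAt A a u) :
    HasDerivAt (fun s => (A s).im) a.im u :=
  (Complex.imCLM.hasFDerivAt.comp_hasDerivAt u h)

lemma hasFDerivAt_quadratic {a b : ℝ → ℝ} {a' b' : ℝ} {p : Pt} (ha : HasDerivAt a a' (p 0))
    (hb : HasDerivAt b b' (p 0)) :
    ∃ L : Pt →L[ℝ] ℝ,
      HasFDerivAt (fun q : Pt => (1 / 2) * (a (q 0) * (q 2 ^ 2 - q 3 ^ 2))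
        - b (q 0) * (q 2 * q 3)) L p ∧
      ∀ i, L (Pi.single i 1) = ![(1 / 2) * (a' * (p 2 ^ 2 - p 3 ^ 2)) - b' * (p 2 * p 3), 0,
        a (p 0) * p 2 - b (p 0) * p 3, -(a (p 0) * p 3) - b (p 0) * p 2] i := by
  have h0 := hasFDerivAt_coord 0 p
  have h2 := hasFDerivAt_coord 2 p
  have h3 := hasFDerivAt_coord 3 p
  refine ⟨_, (((ha.comp_hasFDerivAt p h0).mul ((h2.pow 2).sub (h3.pow 2))).const_mul _).sub
    ((hb.comp_hasFDerivAt p h0).mul (h2.mul h3)), fun i => ?_⟩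
  fin_cases i <;> simp <;> ring

lemma hasFDerivAt_linear {a b : ℝ → ℝ} {a' b' : ℝ} {p : Pt} (ha : HasDerivAt a a' (p 0))
    (hb : HasDerivAt b b' (p 0)) :
    ∃ L : Pt →L[ℝ] ℝ,
      HasFDerivAt (fun q : Pt => a (q 0) * q 2 + b (q 0) * q 3) L p ∧
      ∀ i, L (Pi.single i 1) = ![a' * p 2 + b' * p 3, 0, a (p 0), b (p 0)] i := by
  have h0 := hasFDerivAt_coord 0 p
  have h2 := hasFDerivAt_coord 2 p
  have h3 := hasFDerivAt_coord 3 p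
  refine ⟨_, ((ha.comp_hasFDerivAt p h0).mul h2).add ((hb.comp_hasFDerivAt p h0).mul h3),
    fun i => ?_⟩
  fin_cases i <;> simp <;> ring

lemma pd_profileH {A A' : ℝ → ℂ} {p : Pt} (h : HasDerivAt A (A' (p 0)) (p 0)) (i : Fin 4) :
    pd i (profileH A) p = dH A A' p i := by
  rw [funext (profileH_eq A)]
  obtain ⟨L, hL, hi⟩ := hasFDerivAt_quadratic (hasDerivAt_re h) (hasDerivAt_im h)
  rw [pd_eq hL, hi, dH]

lemma differentiableAt_profileH {A A' : ℝ → ℂ} {p : Pt} (h : HasDerivAt A (A' (p 0)) (p 0)) :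
    DifferentiableAt ℝ (profileH A) p := by
  rw [funext (profileH_eq A)]
  obtain ⟨L, hL, -⟩ := hasFDerivAt_quadratic (hasDerivAt_re h) (hasDerivAt_im h)
  exact hL.differentiableAt

lemma brinkmann_inv (A : ℝ → ℂ) (p : Pt) :
    (brinkmann A p)⁻¹ = !![0, -1, 0, 0; -1, 2 * profileH A p, 0, 0; 0, 0, 1, 0; 0, 0, 0, 1] := by
  apply Matrix.inv_eq_right_inv
  ext i j
  fin_cases i <;> fin_cases j <;> simp [brinkmann, Matrix.mul_apply, Fin.sum_univ_four]

lemma pd_brinkmann {A A' : ℝ → ℂ} {p : Pt} (h : HasDerivAt A (A' (p 0)) (p 0)) (i c d : Fin 4) :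
    pd i (fun q => brinkmann A q c d) p = if c = 0 ∧ d = 0 then -2 * dH A A' p i else 0 := by
  have key : pd i (fun q => -2 * profileH A q) p = -2 * dH A A' p i := by
    rw [pd_eq ((differentiableAt_profileH h).hasFDerivAt.const_mul (-2)), ← pd_profileH h, pd]
    simp
  fin_cases c <;> fin_cases d <;> simp [brinkmann]
  simpa using key

/-- The Christoffel symbols of the Brinkmann metric in terms of the differential of `H`. -/
def christoffelOf (h : Fin 4 → ℝ) (a b c : Fin 4) : ℝ :=
  (if a = 1 then (if b = 0 then h c else 0) + (if c = 0 then h b else 0)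
      - (if b = 0 ∧ c = 0 then h 0 else 0) else 0)
    + (if (a = 2 ∨ a = 3) ∧ b = 0 ∧ c = 0 then h a else 0)

lemma christoffel_brinkmann {A A' : ℝ → ℂ} {p : Pt} (h : HasDerivAt A (A' (p 0)) (p 0))
    (a b c : Fin 4) : christoffel (brinkmann A) p a b c = christoffelOf (dH A A' p) a b c := by
  have h1 : dH A A' p 1 = 0 := by simp [dH]
  simp only [christoffel, pd_brinkmann h, brinkmann_inv, Fin.sum_univ_four, christoffelOf]
  fin_cases a <;> fin_cases b <;> fin_cases c <;> simp [h1]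

/-- The Hessian of `H` in the transverse directions. -/
def hessH (z : ℂ) (i j : Fin 4) : ℝ :=
  !![0, 0, 0, 0; 0, 0, 0, 0; 0, 0, z.re, -z.im; 0, 0, -z.im, -z.re] i j

/-- These facts on the second derivatives are all the curvature needs: those involving u enter it
only through their symmetry and cancel, so A' and A'' leave no trace. -/
lemma hasDerivAt_dH {A A' : ℝ → ℂ} {A'' : ℂ} {p : Pt} (h : HasDerivAt A (A' (p 0)) (p 0))
    (h' : HasDerivAt A' A'' (p 0)) :
    ∃ D : Fin 4 → Pt →L[ℝ] ℝ, (∀ j, HasFDerivAt (fun q => dH A A' q j) (D j) p) ∧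
      (∀ j, D 1 (Pi.single j 1) = 0) ∧
      (∀ i j, D i (Pi.single j 1) = D j (Pi.single i 1)) ∧
      ∀ i j, i ≠ 0 → j ≠ 0 → D i (Pi.single j 1) = hessH (A (p 0)) i j := by
  obtain ⟨L0, hL0, e0⟩ := hasFDerivAt_quadratic (hasDerivAt_re h') (hasDerivAt_im h')
  obtain ⟨L2, hL2, e2⟩ := hasFDerivAt_linear (hasDerivAt_re h) (hasDerivAt_im h).fun_neg
  obtain ⟨L3, hL3, e3⟩ := hasFDerivAt_linear (hasDerivAt_im h).fun_neg (hasDerivAt_re h).fun_neg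
  refine ⟨![L0, 0, L2, L3], ?_, ?_, ?_, ?_⟩
  · intro j
    fin_cases j
    · simpa [dH] using hL0
    · simpa [dH] using hasFDerivAt_const (𝕜 := ℝ) (0 : ℝ) p
    · refine hL2.congr_of_eventuallyEq (.of_forall fun q => ?_)
      simp [dH]; ring
    · refine hL3.congr_of_eventuallyEq (.of_forall fun q => ?_)
      simp [dH]; ring
  · simp
  · intro i j
    fin_cases i <;> fin_cases j <;> simp [e0, e2, e3] <;> ring
  · intro i j
    fin_cases i <;> fin_cases j <;> simp [e0, e2, e3, hessH]

/-- `christoffelOf` is linear in h with constant coefficients, so a derivative passes through to h.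
-/
lemma pd_christoffelOf {h : Pt → Fin 4 → ℝ} {D : Fin 4 → Pt →L[ℝ] ℝ} {p : Pt}
    (hD : ∀ j, HasFDerivAt (fun q => h q j) (D j) p) (i a b c : Fin 4) :
    pd i (fun q => christoffelOf (h q) a b c) p
      = christoffelOf (fun j => D j (Pi.single i 1)) a b c := by
  have key : HasFDerivAt (fun q => christoffelOf (h q) a b c)
      ((if a = 1 then (if b = 0 then D c else 0) + (if c = 0 then D b else 0)
        - (if b = 0 ∧ c = 0 then D 0 else 0) else 0)
        + (if (a = 2 ∨ a = 3) ∧ b = 0 ∧ c = 0 then D a else 0)) p := by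
    have aux : ∀ (P : Prop) [Decidable P] (f : Pt → ℝ) (L : Pt →L[ℝ] ℝ), HasFDerivAt f L p →
        HasFDerivAt (fun q => if P then f q else 0) (if P then L else 0) p := by
      intro P _ f L hf
      split_ifs
      · exact hf
      · exact hasFDerivAt_const _ _
    exact (aux _ _ _ (((aux _ _ _ (hD c)).add (aux _ _ _ (hD b))).sub (aux _ _ _ (hD 0)))).add
      (aux _ _ _ (hD a))
  rw [pd_eq key, christoffelOf]
  split_ifs <;> simp

/-- The curvature is linear in the Hessian of H: since ∂_v H = 0, a product ΓΓ can be nonzero only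
for c = d = 0, where antisymmetry in c, d removes it. -/
lemma riemannUp_brinkmann {A A' : ℝ → ℂ} {A'' : ℂ} {p : Pt}
    (h : ∀ᶠ u in nhds (p 0), HasDerivAt A (A' u) u) (h' : HasDerivAt A' A'' (p 0))
    (a b c d : Fin 4) :
    riemannUp (brinkmann A) p a b c d =
      (if b = 0 then (if d = 0 then hessH (A (p 0)) a c else 0)
          - (if c = 0 then hessH (A (p 0)) a d else 0) else 0)
        - (if a = 1 then (if c = 0 then hessH (A (p 0)) b d else 0)
          - (if d = 0 then hessH (A (p 0)) b c else 0) else 0) := by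
  have hp := h.self_of_nhds
  obtain ⟨D, hD, D1, Ds, Dh⟩ := hasDerivAt_dH hp h'
  have hc : ∀ i a b c, pd i (fun q => christoffel (brinkmann A) q a b c) p
      = christoffelOf (fun j => D j (Pi.single i 1)) a b c := by
    intro i a b c
    rw [← pd_christoffelOf hD]
    refine pd_congr ?_ i
    have := (continuous_apply (0 : Fin 4)).continuousAt (x := p) |>.eventually h
    filter_upwards [this] with q hq using christoffel_brinkmann hq a b c
  have h1 : dH A A' p 1 = 0 := by simp [dH]
  have D20 := Ds 2 0
  have D30 := Ds 3 0
  have D32 := Ds 3 2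
  have D10 : ∀ j, D j (Pi.single 1 1) = 0 := fun j => by rw [Ds, D1]
  have E22 := Dh 2 2 (by decide) (by decide)
  have E23 := Dh 2 3 (by decide) (by decide)
  have E33 := Dh 3 3 (by decide) (by decide)
  simp only [riemannUp, hc, christoffel_brinkmann hp, Fin.sum_univ_four]
  fin_cases a <;> fin_cases b <;> fin_cases c <;> fin_cases d <;>
    simp [christoffelOf, h1, D1, D10, D20, D30, D32, E22, E23, E33, hessH]

lemma eventually_hasDerivAt_deriv {A : ℝ → ℂ} {u : ℝ} (hA : ContDiffAt ℝ 2 A u) :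
    (∀ᶠ s in nhds u, HasDerivAt A (deriv A s) s) ∧ HasDerivAt (deriv A) (deriv (deriv A) u) u := by
  constructor
  · filter_upwards [hA.eventually (by simp)] with s hs
    exact (hs.differentiableAt (by simp)).hasDerivAt
  · have : ContDiffAt ℝ 1 (fderiv ℝ A) u := hA.fderiv_right (by norm_num)
    have h2 : DifferentiableAt ℝ (fun s => fderiv ℝ A s 1) u :=
      (this.differentiableAt (by simp)).clm_apply (differentiableAt_const _)
    exact DifferentiableAt.hasDerivAt h2

/-- The only possible Ricci component is the transverse Laplacian of H, which vanishes because H is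
the real part of a function holomorphic in ζ. -/
lemma ricci_brinkmann {A : ℝ → ℂ} {p : Pt} (hA : ContDiffAt ℝ 2 A (p 0)) (b d : Fin 4) :
    ricci (brinkmann A) p b d = 0 := by
  obtain ⟨h, h'⟩ := eventually_hasDerivAt_deriv hA
  simp only [ricci, riemannUp_brinkmann h h', Fin.sum_univ_four]
  fin_cases b <;> fin_cases d <;> simp [hessH]

lemma riemann_brinkmann {A : ℝ → ℂ} {p : Pt} (hA : ContDiffAt ℝ 2 A (p 0)) (a b c d : Fin 4) :
    riemann (brinkmann A) p a b c d =
      (if a = 0 then (if c = 0 then hessH (A (p 0)) b d else 0)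
          - (if d = 0 then hessH (A (p 0)) b c else 0) else 0)
        - (if b = 0 then (if c = 0 then hessH (A (p 0)) a d else 0)
          - (if d = 0 then hessH (A (p 0)) a c else 0) else 0) := by
  obtain ⟨h, h'⟩ := eventually_hasDerivAt_deriv hA
  have h0 : ∀ z j, hessH z 0 j = 0 := fun z j => by fin_cases j <;> simp [hessH]
  have h1 : ∀ z j, hessH z 1 j = 0 := fun z j => by fin_cases j <;> simp [hessH]
  simp only [riemann, riemannUp_brinkmann h h', Fin.sum_univ_four]
  fin_cases a <;> simp [brinkmann, h0, h1] <;> split_ifs <;> ring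

/-- A Brinkmann plane wave is a vacuum solution: its Weyl and Riemann tensors agree. -/
lemma weyl_brinkmann {A : ℝ → ℂ} {p : Pt} (hA : ContDiffAt ℝ 2 A (p 0)) (a b c d : Fin 4) :
    weyl (brinkmann A) p a b c d = riemann (brinkmann A) p a b c d := by
  simp [weyl, scalarCurv, ricci_brinkmann hA]

/-- Since m⁰ = 0, only (n⁰)² times the Hessian of H on (m̄, m̄) remains. As m̄ is proportional to
(1, -i), this selects 2(Re A + i Im A), that is 2A. -/
lemma Psi4_brinkmann {A : ℝ → ℂ} {p : Pt} (hA : ContDiffAt ℝ 2 A (p 0)) {E : Tetrad}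
    (h0 : E.m 0 = 0) (h3 : E.m 3 = Complex.I * E.m 2) :
    Psi4 (brinkmann A) p E = 2 * ((E.n 0 : ℂ) * conj (E.m 2)) ^ 2 * A (p 0) := by
  simp only [Psi4, weyl_brinkmann hA, riemann_brinkmann hA, Fin.sum_univ_four]
  simp [h0, h3, hessH]
  linear_combination (2 * ((E.n 0 : ℂ) * conj (E.m 2)) ^ 2) * Complex.re_add_im (A (p 0))
    - ((E.n 0 : ℂ) * conj (E.m 2)) ^ 2 * ((A (p 0)).re) * Complex.I_sq

/-! ### Null tetrads with ℓ along ∂_v, and their spin coefficient γ. -/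

lemma ip_brinkmann (A : ℝ → ℂ) (p : Pt) (X Y : Fin 4 → ℂ) :
    ip (brinkmann A) p X Y = -2 * (profileH A p : ℂ) * X 0 * Y 0 - X 0 * Y 1 - X 1 * Y 0
      + X 2 * Y 2 + X 3 * Y 3 := by
  simp [ip, brinkmann, Fin.sum_univ_four]; ring

lemma rip_brinkmann (A : ℝ → ℂ) (p : Pt) (X Y : Fin 4 → ℝ) :
    rip (brinkmann A) p X Y = -2 * profileH A p * X 0 * Y 0 - X 0 * Y 1 - X 1 * Y 0
      + X 2 * Y 2 + X 3 * Y 3 := by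
  simp [rip, brinkmann, Fin.sum_univ_four]; ring

/-- The form of a null tetrad whose `ℓ` is a multiple of `∂_v` and whose `m` is oriented. -/
lemma IsNullTetrad.components {A : ℝ → ℂ} {p : Pt} {E : Tetrad} {b : ℝ}
    (hE : IsNullTetrad (brinkmann A) p E) (hb : 0 < b) (hl : E.l = Pi.single 1 b)
    (ho : 0 < (conj (E.m 2) * E.m 3).im) :
    b * E.n 0 = 1 ∧ E.m 0 = 0 ∧ E.m 3 = Complex.I * E.m 2 ∧ 2 * (E.m 2 * conj (E.m 2)) = 1 := by
  obtain ⟨-, -, hln, hmm, hmc, hlm, -⟩ := hE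
  rw [rip_brinkmann] at hln
  rw [ip_brinkmann] at hmm hmc hlm
  have hb' : (b : ℂ) ≠ 0 := by exact_mod_cast hb.ne'
  have hm0 : E.m 0 = 0 := by simpa [cvec, hl, hb'] using hlm
  have hn : b * E.n 0 = 1 := by simpa [hl] using hln
  have h23 : E.m 3 = Complex.I * E.m 2 := by
    -- Nullity of m leaves two circular directions; the orientation excludes the second, whose
    -- imaginary part would be -|m²|².
    have : (E.m 3 - Complex.I * E.m 2) * (E.m 3 + Complex.I * E.m 2) = 0 := by
      have := Complex.I_sq
      simp only [hm0] at hmm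
      linear_combination hmm - (E.m 2) ^ 2 * this
    rcases mul_eq_zero.1 this with h | h
    · exact sub_eq_zero.1 h
    · rw [eq_neg_of_add_eq_zero_left h] at ho
      exfalso
      have : (conj (E.m 2) * -(Complex.I * E.m 2)).im = -Complex.normSq (E.m 2) := by
        simp [Complex.normSq_apply, Complex.mul_im]
      rw [this] at ho
      linarith [Complex.normSq_nonneg (E.m 2)]
  refine ⟨hn, hm0, h23, ?_⟩
  simp only [hm0, conjVec, h23, map_mul, map_zero, Complex.conj_I] at hmc
  linear_combination hmc + E.m 2 * conj (E.m 2) * Complex.I_sq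

lemma PlaneWave.uRange_isOpen (M : PlaneWave) : IsOpen M.uRange :=
  (isOpenMap_eval (0 : Fin 4)) _ M.isOpen

lemma PlaneWave.mem_uRange (M : PlaneWave) {p : Pt} (hp : p ∈ M.U) : p 0 ∈ M.uRange :=
  ⟨p, hp, rfl⟩

lemma PlaneWave.contDiffAt (M : PlaneWave) {u : ℝ} (hu : u ∈ M.uRange) : ContDiffAt ℝ ∞ M.A u :=
  M.smooth.contDiffAt (M.uRange_isOpen.mem_nhds hu)

lemma PlaneWave.contDiffAt_two (M : PlaneWave) {u : ℝ} (hu : u ∈ M.uRange) :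
    ContDiffAt ℝ 2 M.A u :=
  contDiffAt_infty.1 (M.contDiffAt hu) 2

lemma PlaneWave.hasDerivAt (M : PlaneWave) {u : ℝ} (hu : u ∈ M.uRange) :
    HasDerivAt M.A (deriv M.A u) u :=
  ((M.contDiffAt hu).differentiableAt (by simp)).hasDerivAt

lemma PlaneWave.IsCanonical.normalization {M : PlaneWave} {T : Pt → Tetrad}
    (hT : M.IsCanonical T) {p : Pt} (hp : p ∈ M.U) :
    (∃ b : ℝ, (T p).l = Pi.single 1 b ∧ b * (T p).n 0 = 1) ∧ 0 < (T p).n 0 ∧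
      (T p).m 0 = 0 ∧ (T p).m 3 = Complex.I * (T p).m 2 ∧
      2 * ((T p).m 2 * conj ((T p).m 2)) = 1 ∧
      2 * (((T p).n 0 : ℂ) * conj ((T p).m 2)) ^ 2 * M.A (p 0) = 1 := by
  obtain ⟨-, -, -, h⟩ := hT
  obtain ⟨hE, ⟨b, hb, hl⟩, ho, hΨ⟩ := h p hp
  obtain ⟨h1, h2, h3, h4⟩ := hE.components hb hl ho
  refine ⟨⟨b, hl, h1⟩, ?_, h2, h3, h4, ?_⟩
  · exact pos_of_mul_pos_right (a := b) (by rw [h1]; exact one_pos) hb.le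
  · rw [← hΨ]
    exact (Psi4_brinkmann (M.contDiffAt_two (M.mem_uRange hp)) h2 h3).symm

/-- The spin coefficient `γ` is the same invariant `A' / (4 A √|A|)` in every canonical coframe. -/
theorem PlaneWave.IsCanonical.spinGamma_eq {M : PlaneWave} {T : Pt → Tetrad}
    (hT : M.IsCanonical T) {p : Pt} (hp : p ∈ M.U) :
    spinGamma M.g T p
      = deriv M.A (p 0) / (4 * M.A (p 0) * (Real.sqrt ‖M.A (p 0)‖ : ℂ)) := by
  have hnb : M.U ∈ nhds p := M.isOpen.mem_nhds hp
  have hu := M.mem_uRange hp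
  have hA := M.hasDerivAt hu
  obtain ⟨⟨b, hl, hbn⟩, hn, hm0, hm3, hm2, hΨ⟩ := hT.normalization hp
  have hev : ∀ᶠ q in nhds p, q ∈ M.U := hnb
  have hnd : DifferentiableAt ℝ (fun q => (T q).n) p :=
    (hT.2.1.contDiffAt hnb).differentiableAt (by simp)
  have hmd : DifferentiableAt ℝ (fun q => (T q).m) p :=
    (hT.2.2.1.contDiffAt hnb).differentiableAt (by simp)
  have hν : DifferentiableAt ℝ (fun q => ((T q).n 0 : ℂ)) p :=
    Complex.ofRealCLM.differentiableAt.comp p (differentiableAt_pi.1 hnd 0)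
  have hμ : DifferentiableAt ℝ (fun q => conj ((T q).m 2)) p :=
    Complex.conjCLE.differentiableAt.comp p (differentiableAt_pi.1 hmd 2)
  have hAp : HasFDerivAt (fun q : Pt => M.A (q 0))
      ((ContinuousLinearMap.proj (R := ℝ) (φ := fun _ : Fin 4 => ℝ) 0).smulRight
        (deriv M.A (p 0))) p := by
    have := HasFDerivAt.comp (f := fun q : Pt => q 0) p hA.hasFDerivAt (hasFDerivAt_coord 0 p)
    refine this.congr_fderiv ?_
    ext
    simp
  set ν : ℂ := ((T p).n 0 : ℂ) with hνdef
  set μ : ℂ := conj ((T p).m 2) with hμdef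
  set a := M.A (p 0) with ha
  -- Differentiating 2(νμ)²A = 1, which holds near p, and cancelling 2νμ gives ∂ν/ν + ∂μ/μ =
  -- -∂A/(2A).
  have rel : ∀ i, 2 * (pd i (fun q => ((T q).n 0 : ℂ)) p * μ
      + ν * pd i (fun q => conj ((T q).m 2)) p) * a
      + ν * μ * (if i = 0 then deriv M.A (p 0) else 0) = 0 := by
    intro i
    have h1 := (((hν.hasFDerivAt.mul hμ.hasFDerivAt).pow 2).const_mul 2).mul hAp
    have h2 : HasFDerivAt (fun q => 2 * (((T q).n 0 : ℂ) * conj ((T q).m 2)) ^ 2 * M.A (q 0))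
        (0 : Pt →L[ℝ] ℂ) p := by
      refine (hasFDerivAt_const (1 : ℂ) p).congr_of_eventuallyEq ?_
      filter_upwards [hev] with q hq using (hT.normalization hq).2.2.2.2.2
    have h3 := congrArg (fun L : Pt →L[ℝ] ℂ => L (Pi.single i 1)) (h1.unique h2)
    have hνμ : 2 * (ν * μ) ≠ 0 := by
      intro h
      have : ν * μ = 0 := by simpa using h
      rw [this] at hΨ
      simp at hΨ
    apply mul_left_cancel₀ hνμ
    simp [Pi.single_apply, eq_comm (a := (0 : Fin 4)), ← hνdef, ← hμdef, ← ha] at h3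
    simp only [pd]
    split_ifs at h3 ⊢ <;> linear_combination h3
  have hχ : ∀ a b c, christoffel (brinkmann M.A) p a b c = christoffelOf (dH M.A (deriv M.A) p) a b c :=
    christoffel_brinkmann hA
  have hconj0 : ∀ i, pd i (fun q => conj ((T q).m 0)) p = 0 := fun i => by
    rw [pd_congr (h := fun _ => (0 : ℂ)), pd_const]
    filter_upwards [hev] with q hq
    simp [(hT.normalization hq).2.2.1]
  have hconj3 : ∀ i, pd i (fun q => conj ((T q).m 3)) p
      = -Complex.I * pd i (fun q => conj ((T q).m 2)) p := fun i => by
    rw [pd_congr (h := fun q => -Complex.I * conj ((T q).m 2)),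
      pd_eq (hμ.hasFDerivAt.const_mul _)]
    · rfl
    filter_upwards [hev] with q hq
    simp [(hT.normalization hq).2.2.2.1]
  -- Taking moduli in 2(νμ)²A = 1 with 2|μ|² = 1 gives ν²|A| = 1.
  have hnorm : Real.sqrt ‖a‖ * (T p).n 0 = 1 := by
    have h1 := congrArg norm hΨ
    have h2 := congrArg norm hm2
    simp only [norm_mul, norm_pow, hνdef, hμdef, Complex.norm_real, RCLike.norm_conj,
      Complex.norm_ofNat, norm_one, Real.norm_of_nonneg hn.le] at h1 h2
    have h3 : ((T p).n 0) ^ 2 * ‖a‖ = 1 := by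
      linear_combination h1 - (T p).n 0 ^ 2 * ‖a‖ * h2
    have h4 : (Real.sqrt ‖a‖ * (T p).n 0) ^ 2 = 1 := by
      rw [mul_pow, Real.sq_sqrt (norm_nonneg _)]; linarith
    exact (pow_eq_one_iff_of_nonneg (by positivity) two_ne_zero).1 h4
  have hnormC : (Real.sqrt ‖a‖ : ℂ) * ν = 1 := by rw [hνdef]; exact_mod_cast hnorm
  have ha0 : a ≠ 0 := M.ne_zero _ hu
  have hs0 : (Real.sqrt ‖a‖ : ℂ) ≠ 0 := left_ne_zero_of_mul_eq_one hnormC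
  have hbC : (b : ℂ) * ν = 1 := by rw [hνdef]; exact_mod_cast hbn
  have hν0 : ν ≠ 0 := right_ne_zero_of_mul_eq_one hbC
  have hμ0 : μ ≠ 0 := fun h => by rw [h] at hm2; simp at hm2
  have hb : (b : ℂ) = 1 / ν := by field_simp; exact hbC
  have hm2' : (T p).m 2 = 1 / (2 * μ) := by field_simp; linear_combination hm2
  -- The Christoffel terms drop out: pairing with ℓ sees only the upper index 0, where Γ vanishes,
  -- and Γ² and Γ³ act only on m̄⁰ = 0.
  have hγ : spinGamma M.g T p = -(1 / 2) * ∑ i, ((T p).n i : ℂ)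
      * (pd i (fun q => ((T q).n 0 : ℂ)) p / ν + pd i (fun q => conj ((T q).m 2)) p / μ) := by
    have e1 : ip M.g p (nabla M.g (cvec (T p).n) (fun q => cvec (T q).n) p) (cvec (T p).l)
        = -(∑ i, ((T p).n i : ℂ) * pd i (fun q => ((T q).n 0 : ℂ)) p) * b := by
      rw [PlaneWave.g, ip_brinkmann, hl]
      simp [nabla, hχ, christoffelOf, cvec]
    have e2 : ip M.g p (nabla M.g (cvec (T p).n) (fun q => conjVec (T q).m) p) (T p).m
        = (∑ i, ((T p).n i : ℂ) * pd i (fun q => conj ((T q).m 2)) p) * (2 * (T p).m 2) := by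
      rw [PlaneWave.g, ip_brinkmann]
      simp [nabla, hχ, christoffelOf, cvec, conjVec, hm0, hconj0, hconj3, hm3,
        Fin.sum_univ_four]
      ring_nf
      simp only [Complex.I_sq]
      ring
    rw [spinGamma, e1, e2, hb, hm2', Fin.sum_univ_four, Fin.sum_univ_four, Fin.sum_univ_four]
    field_simp
    ring
  have hi : ∀ i, pd i (fun q => ((T q).n 0 : ℂ)) p / ν + pd i (fun q => conj ((T q).m 2)) p / μ
      = -(if i = 0 then deriv M.A (p 0) else 0) / (2 * a) := fun i => by
    field_simp
    linear_combination rel i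
  rw [hγ, Fin.sum_univ_four, hi, hi, hi, hi, ← hνdef]
  simp
  field_simp
  linear_combination 4 * deriv M.A (p 0) * hnormC

/-! ### Normalization of the amplitude -/

lemma PlaneWave.uRange_isPreconnected (M : PlaneWave) : IsPreconnected M.uRange :=
  M.connected.isPreconnected.image _ (continuous_apply (0 : Fin 4)).continuousOn

lemma hasDerivAt_normSq {A : ℝ → ℂ} {a : ℂ} {u : ℝ} (h : HasDerivAt A a u) :
    HasDerivAt (fun s => Complex.normSq (A s)) (2 * (conj (A u) * a).re) u := by
  simp only [Complex.normSq_apply]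
  refine (((hasDerivAt_re h).mul (hasDerivAt_re h)).add
    ((hasDerivAt_im h).mul (hasDerivAt_im h))).congr_deriv ?_
  simp [Complex.mul_re]
  ring

/-- If the spin coefficient `γ` of a canonical coframe is imaginary, then `|A|` is constant. -/
lemma PlaneWave.IsCanonical.norm_eq {M : PlaneWave} {T : Pt → Tetrad} (hT : M.IsCanonical T)
    (hγ : ∀ p ∈ M.U, conj (spinGamma M.g T p) = -spinGamma M.g T p) {u u₀ : ℝ}
    (hu : u ∈ M.uRange) (hu₀ : u₀ ∈ M.uRange) : ‖M.A u‖ = ‖M.A u₀‖ := by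
  have hd : ∀ u ∈ M.uRange, (conj (M.A u) * deriv M.A u).re = 0 := by
    rintro _ ⟨p, hp, rfl⟩
    have h := hγ p hp
    have hA : M.A (p 0) ≠ 0 := M.ne_zero _ ⟨p, hp, rfl⟩
    have hs : (Real.sqrt ‖M.A (p 0)‖ : ℂ) ≠ 0 := by
      have := Real.sqrt_pos.2 (norm_pos_iff.2 hA)
      exact_mod_cast this.ne'
    have hre : (spinGamma M.g T p).re = 0 := by
      have := congrArg Complex.re h
      simp only [Complex.conj_re, Complex.neg_re] at this
      linarith
    -- ĀA' is a real multiple of γ, so its real part, half the derivative of |A|², vanishes with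
    -- that of γ.
    have he : conj (M.A (p 0)) * deriv M.A (p 0)
        = ((4 * Real.sqrt ‖M.A (p 0)‖ * Complex.normSq (M.A (p 0)) : ℝ) : ℂ)
          * spinGamma M.g T p := by
      rw [hT.spinGamma_eq hp]
      push_cast
      rw [Complex.normSq_eq_conj_mul_self]
      field_simp
    simp only [he, Complex.re_ofReal_mul, hre, mul_zero]
  have hc := M.uRange_isOpen.is_const_of_deriv_eq_zero M.uRange_isPreconnected
    (f := fun s => Complex.normSq (M.A s))
    (fun s hs => (hasDerivAt_normSq (M.hasDerivAt hs)).differentiableAt.differentiableWithinAt)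
    (fun s hs => by
      rw [(hasDerivAt_normSq (M.hasDerivAt hs)).deriv, hd s hs]; simp) hu hu₀
  simpa [Complex.normSq_eq_norm_sq] using hc

/-- The linear change of coordinates `(u, v, x, y) ↦ (k u, k⁻¹ v, x, y)`. -/
def scale (k : ℝ) : Pt →L[ℝ] Pt :=
  ContinuousLinearMap.pi ![k • ContinuousLinearMap.proj 0, k⁻¹ • ContinuousLinearMap.proj 1,
    ContinuousLinearMap.proj 2, ContinuousLinearMap.proj 3]

lemma scale_apply (k : ℝ) (p : Pt) : scale k p = ![k * p 0, k⁻¹ * p 1, p 2, p 3] := by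
  ext i
  fin_cases i <;> simp [scale]

lemma scale_inv_scale {k : ℝ} (hk : k ≠ 0) (p : Pt) : scale k⁻¹ (scale k p) = p := by
  ext i
  fin_cases i <;> simp [scale_apply, hk]

lemma scale_scale_inv {k : ℝ} (hk : k ≠ 0) (p : Pt) : scale k (scale k⁻¹ p) = p := by
  simpa using scale_inv_scale (inv_ne_zero hk) p

/-- The plane wave `M` in the coordinates `(k u, k⁻¹ v, x, y)`. -/
def PlaneWave.rescale (M : PlaneWave) (k : ℝ) (hk : k ≠ 0) : PlaneWave where
  U := scale k⁻¹ ⁻¹' M.U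
  isOpen := M.isOpen.preimage (scale k⁻¹).continuous
  connected := by
    have : scale k⁻¹ ⁻¹' M.U = scale k '' M.U :=
      (congrFun (Set.image_eq_preimage_of_inverse (scale_inv_scale hk) (scale_scale_inv hk)) _).symm
    rw [this]
    exact M.connected.image _ (scale k).continuous.continuousOn
  -- du² contributes the factor k⁻², while du dv is unchanged.
  A := fun s => M.A (k⁻¹ * s) / (k : ℂ) ^ 2
  smooth := by
    refine ContDiffOn.div_const (M.smooth.comp (contDiff_const.mul contDiff_id).contDiffOn ?_) _
    rintro _ ⟨q, hq, rfl⟩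
    exact ⟨_, hq, by simp [scale_apply]⟩
  ne_zero := by
    rintro _ ⟨q, hq, rfl⟩
    have : M.A (k⁻¹ * q 0) ≠ 0 := M.ne_zero _ ⟨_, hq, by simp [scale_apply]⟩
    have hk' : (k : ℂ) ≠ 0 := by exact_mod_cast hk
    positivity

lemma PlaneWave.rescale_mem {M : PlaneWave} {k : ℝ} {hk : k ≠ 0} {u : ℝ}
    (hu : u ∈ (M.rescale k hk).uRange) : k⁻¹ * u ∈ M.uRange := by
  obtain ⟨q, hq, rfl⟩ := hu
  exact ⟨_, hq, by simp [scale_apply]⟩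

lemma PlaneWave.isCoordChange_scale (M : PlaneWave) {k : ℝ} (hk : k ≠ 0) :
    IsCoordChange M.g M.U (M.rescale k hk).g (M.rescale k hk).U (scale k) := by
  have hmaps : Set.MapsTo (scale k) M.U (M.rescale k hk).U := fun p hp => by
    simpa [PlaneWave.rescale, scale_inv_scale hk] using hp
  refine ⟨(scale k).contDiff.contDiffOn, hmaps,
    ⟨scale k⁻¹, (scale k⁻¹).contDiff.contDiffOn, fun q hq => hq,
      fun p _ => scale_inv_scale hk p, fun q _ => scale_scale_inv hk q⟩, fun p _ X Y => ?_⟩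
  have hH : profileH (M.rescale k hk).A (scale k p) = profileH M.A p / k ^ 2 := by
    simp only [profileH_eq, PlaneWave.rescale, scale_apply, ← Complex.ofReal_pow,
      Complex.div_ofReal_re, Complex.div_ofReal_im]
    simp [hk]
    ring
  rw [(scale k).fderiv, PlaneWave.g, PlaneWave.g, rip_brinkmann, rip_brinkmann, hH, scale_apply,
    scale_apply]
  simp
  field_simp

/-- A plane wave of unit amplitude is `A = exp (4 i G)` with `G' = g` real. -/
lemma PlaneWave.exists_phase (N : PlaneWave) (h1 : ∀ u ∈ N.uRange, ‖N.A u‖ = 1) :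
    ∃ g G : ℝ → ℝ, ContDiffOn ℝ ∞ g N.uRange ∧ (∀ u ∈ N.uRange, HasDerivAt G (g u) u) ∧
      (∀ u ∈ N.uRange, N.A u = Complex.exp (4 * (Complex.I * (G u : ℂ)))) ∧
      ∀ u ∈ N.uRange, deriv N.A u = 4 * N.A u * (Complex.I * (g u : ℂ)) := by
  -- The real part of A'/(4A) vanishes because |A| = 1, so A'/(4A) = ig.
  set g : ℝ → ℝ := fun u => (deriv N.A u / (4 * N.A u)).im with hg
  have hne : ∀ u ∈ N.uRange, N.A u ≠ 0 := N.ne_zero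
  have hgs : ContDiffOn ℝ ∞ g N.uRange := by
    have hA : ContDiffOn ℝ ∞ N.A N.uRange := N.smooth
    have hA' : ContDiffOn ℝ ∞ (deriv N.A) N.uRange :=
      ((contDiffOn_infty_iff_deriv_of_isOpen N.uRange_isOpen).1 hA).2
    have hq : ContDiffOn ℝ ∞ (fun u => deriv N.A u / (4 * N.A u)) N.uRange := by
      simp only [div_eq_mul_inv]
      exact hA'.mul ((contDiffOn_const.mul hA).inv
        fun u hu => mul_ne_zero (by norm_num) (hne u hu))
    exact Complex.imCLM.contDiff.comp_contDiffOn hq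
  have hA' : ∀ u ∈ N.uRange, deriv N.A u = 4 * N.A u * (Complex.I * (g u : ℂ)) := by
    intro u hu
    have hd := hasDerivAt_normSq (N.hasDerivAt hu)
    have hc : HasDerivAt (fun s => Complex.normSq (N.A s)) 0 u := by
      refine (hasDerivAt_const u (1 : ℝ)).congr_of_eventuallyEq ?_
      filter_upwards [N.uRange_isOpen.mem_nhds hu] with s hs
      rw [Complex.normSq_eq_norm_sq, h1 s hs]; norm_num
    have h0 : (conj (N.A u) * deriv N.A u).re = 0 := by linarith [hd.unique hc]
    have hre : (deriv N.A u / (4 * N.A u)).re = 0 := by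
      have : deriv N.A u / (4 * N.A u) = ((1 / 4 : ℝ) : ℂ) * (conj (N.A u) * deriv N.A u) := by
        have h2 : N.A u * conj (N.A u) = 1 := by
          rw [Complex.mul_conj, Complex.normSq_eq_norm_sq, h1 u hu]; norm_num
        rw [div_eq_iff (mul_ne_zero (by norm_num) (hne u hu))]
        push_cast
        linear_combination (-deriv N.A u) * h2
      rw [this, Complex.re_ofReal_mul, h0, mul_zero]
    have : deriv N.A u / (4 * N.A u) = Complex.I * (g u : ℂ) := by
      apply Complex.ext <;> simp [hre, hg]
    rw [← this]
    field_simp [hne u hu]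
  obtain ⟨u₀, hu₀⟩ : N.uRange.Nonempty := N.connected.nonempty.image _
  have hord := N.uRange_isPreconnected.ordConnected
  -- The constant arg(A(u₀))/4 makes A = exp(4iG) hold at u₀; it spreads because A exp(-4iG) has
  -- derivative zero.
  set G : ℝ → ℝ := fun u => (N.A u₀).arg / 4 + ∫ s in u₀..u, g s with hG
  have hGd : ∀ u ∈ N.uRange, HasDerivAt G (g u) u := fun u hu =>
    (intervalIntegral.integral_hasDerivAt_right
      (hgs.continuousOn.mono (hord.uIcc_subset hu₀ hu)).intervalIntegrable
      (hgs.continuousOn.stronglyMeasurableAtFilter N.uRange_isOpen u hu)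
      (hgs.continuousOn.continuousAt (N.uRange_isOpen.mem_nhds hu))).const_add _
  refine ⟨g, G, hgs, hGd, fun u hu => ?_, hA'⟩
  have hf : ∀ s ∈ N.uRange,
      HasDerivAt (fun s => N.A s * Complex.exp (-(4 * (Complex.I * (G s : ℂ))))) 0 s := by
    intro s hs
    have he := ((((hGd s hs).ofReal_comp).const_mul Complex.I).const_mul 4).fun_neg.cexp
    refine ((N.hasDerivAt hs).mul he).congr_deriv ?_
    rw [hA' s hs]
    ring
  have hc := N.uRange_isOpen.is_const_of_deriv_eq_zero N.uRange_isPreconnected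
    (fun s hs => (hf s hs).differentiableAt.differentiableWithinAt)
    (fun s hs => (hf s hs).deriv) hu hu₀
  have h0 : N.A u₀ = Complex.exp (4 * (Complex.I * (G u₀ : ℂ))) := by
    have := Complex.norm_mul_exp_arg_mul_I (N.A u₀)
    rw [h1 u₀ hu₀] at this
    rw [← this]
    simp [hG]
    congr 1
    ring
  simp only [Complex.exp_neg] at hc
  rw [h0, mul_inv_cancel₀ (Complex.exp_ne_zero _)] at hc
  rwa [mul_inv_eq_one₀ (Complex.exp_ne_zero _)] at hc

/-- The canonical coframe `ℓ = ∂_v`, `n = ∂_u - H ∂_v`, `m = e^{2 i G} (∂_x + i ∂_y) / √2`. -/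
def phaseTetrad (A : ℝ → ℂ) (G : ℝ → ℝ) (p : Pt) : Tetrad where
  l := Pi.single 1 1
  n := ![1, -profileH A p, 0, 0]
  m := ![0, 0, Complex.exp (2 * (Complex.I * (G (p 0) : ℂ))) / (Real.sqrt 2 : ℂ),
    Complex.I * (Complex.exp (2 * (Complex.I * (G (p 0) : ℂ))) / (Real.sqrt 2 : ℂ))]

lemma PlaneWave.isCanonical_phaseTetrad (N : PlaneWave) {G : ℝ → ℝ}
    (hG : ContDiffOn ℝ ∞ G N.uRange)
    (hA : ∀ u ∈ N.uRange, N.A u = Complex.exp (4 * (Complex.I * (G u : ℂ)))) :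
    N.IsCanonical (phaseTetrad N.A G) := by
  have h0 : Set.MapsTo (fun p : Pt => p 0) N.U N.uRange := fun p hp => ⟨p, hp, rfl⟩
  have hc : ∀ i : Fin 4, ContDiff ℝ ∞ (fun p : Pt => p i) := fun i => contDiff_apply ℝ ℝ i
  have hAs : ContDiffOn ℝ ∞ (fun p : Pt => N.A (p 0)) N.U :=
    ContDiffOn.comp (s := N.U) (f := fun p : Pt => p 0) N.smooth (hc 0).contDiffOn h0
  have hH : ContDiffOn ℝ ∞ (profileH N.A) N.U := by
    rw [funext (profileH_eq N.A)]
    have hre := Complex.reCLM.contDiff.comp_contDiffOn hAs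
    have him := Complex.imCLM.contDiff.comp_contDiffOn hAs
    exact (contDiffOn_const.mul (hre.mul (((hc 2).pow 2).sub ((hc 3).pow 2)).contDiffOn)).sub
      (him.mul ((hc 2).mul (hc 3)).contDiffOn)
  have he : ContDiffOn ℝ ∞ (fun p : Pt => Complex.exp (2 * (Complex.I * (G (p 0) : ℂ)))
      / (Real.sqrt 2 : ℂ)) N.U := by
    have hGp : ContDiffOn ℝ ∞ (fun p : Pt => G (p 0)) N.U :=
      ContDiffOn.comp (s := N.U) (f := fun p : Pt => p 0) hG (hc 0).contDiffOn h0
    exact ((contDiffOn_const.mul (contDiffOn_const.mul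
      (Complex.ofRealCLM.contDiff.comp_contDiffOn hGp))).cexp).div_const _
  refine ⟨contDiffOn_const, contDiffOn_pi.2 fun i => ?_, contDiffOn_pi.2 fun i => ?_, ?_⟩
  · fin_cases i
    · exact contDiffOn_const
    · exact hH.neg
    · exact contDiffOn_const
    · exact contDiffOn_const
  · fin_cases i
    · exact contDiffOn_const
    · exact contDiffOn_const
    · exact he
    · exact contDiffOn_const.mul he
  intro p hp
  set e := Complex.exp (2 * (Complex.I * (G (p 0) : ℂ))) / (Real.sqrt 2 : ℂ) with hedef
  have hs := sqrt_two_sq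
  have hs0 : ((Real.sqrt 2 : ℝ) : ℂ) ≠ 0 := fun h => by simp [h] at hs
  have hee : e * conj e = 1 / 2 := by
    simp only [hedef, map_div₀, ← Complex.exp_conj, map_mul, Complex.conj_I, Complex.conj_ofReal,
      map_ofNat]
    rw [div_mul_div_comm, ← Complex.exp_add, ← pow_two, hs]
    simp
  -- The phase 2G in m is half that of A, so Ψ₄ = 2ē²A = 4(eē)² = 1.
  have hAe : N.A (p 0) = 2 * e ^ 2 := by
    rw [hA _ (h0 hp), hedef, div_pow, hs, ← Complex.exp_nat_mul]
    rw [mul_div_cancel₀ _ (by norm_num : (2 : ℂ) ≠ 0)]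
    congr 1
    push_cast
    ring
  refine ⟨?_, ⟨1, one_pos, rfl⟩, ?_, ?_⟩
  · refine ⟨?_, ?_, ?_, ?_, ?_, ?_, ?_⟩ <;>
      simp only [PlaneWave.g, rip_brinkmann, ip_brinkmann] <;>
      simp [phaseTetrad, cvec, conjVec, ← hedef]
    · ring
    · linear_combination e ^ 2 * Complex.I_sq
    · linear_combination 2 * hee - e * conj e * Complex.I_sq
  · have : conj ((phaseTetrad N.A G p).m 2) * (phaseTetrad N.A G p).m 3
        = Complex.I * ((1 / 2 : ℝ) : ℂ) := by
      simp only [phaseTetrad, Matrix.cons_val, ← hedef]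
      push_cast
      linear_combination Complex.I * hee
    rw [this]
    simp
  · refine (Psi4_brinkmann (N.contDiffAt_two (h0 hp)) rfl rfl).trans ?_
    simp only [phaseTetrad, Matrix.cons_val, ← hedef, hAe, Complex.ofReal_one]
    linear_combination (4 * (e * conj e) + 2) * hee

/-! ### Observers -/

lemma isNullTetrad_interpTetrad {A : ℝ → ℂ} {p : Pt} {w : Fin 4 → ℝ}
    (hw : rip (brinkmann A) p w w = -1) :
    w 0 ≠ 0 ∧ IsNullTetrad (brinkmann A) p (interpTetrad w) := by
  rw [rip_brinkmann] at hw
  -- With u̇ = 0 the norm would be ẋ² + ẏ² ≥ 0.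
  have h0 : w 0 ≠ 0 := by
    intro h
    rw [h] at hw
    nlinarith [mul_self_nonneg (w 2), mul_self_nonneg (w 3)]
  have h0C : (w 0 : ℂ) ≠ 0 := by exact_mod_cast h0
  have hr : Real.sqrt 2 ^ 2 = 2 := Real.sq_sqrt (by norm_num)
  have hr0 : Real.sqrt 2 ≠ 0 := by positivity
  have hs := sqrt_two_sq
  have hs0 : ((Real.sqrt 2 : ℝ) : ℂ) ≠ 0 := by exact_mod_cast hr0
  refine ⟨h0, ?_, ?_, ?_, ?_, ?_, ?_, ?_⟩
  · simp [rip_brinkmann, interpTetrad]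
  · simp [rip_brinkmann, interpTetrad]
    field_simp
    linear_combination (Real.sqrt 2) ^ 2 * hw - hr
  · simp [rip_brinkmann, interpTetrad]
    field_simp
  · simp [ip_brinkmann, interpTetrad]
    field_simp
    linear_combination Complex.I_sq
  · simp [ip_brinkmann, interpTetrad, conjVec]
    field_simp
    linear_combination - Complex.I_sq - hs
  · simp [ip_brinkmann, interpTetrad, cvec]
  · simp [ip_brinkmann, interpTetrad, cvec, zeta]
    field_simp
    ring

/-- Here n⁰ = √2 u̇ and m² = -1/√2, so (n⁰m̄²)² = u̇². The transverse velocity enters m only along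
∂_v, which Ψ₄ does not see. -/
lemma Psi4_interpTetrad {A : ℝ → ℂ} {p : Pt} (hA : ContDiffAt ℝ 2 A (p 0)) (w : Fin 4 → ℝ) :
    Psi4 (brinkmann A) p (interpTetrad w) = ((2 * w 0 ^ 2 : ℝ) : ℂ) * A (p 0) := by
  have hs := sqrt_two_sq
  have hs0 : ((Real.sqrt 2 : ℝ) : ℂ) ≠ 0 := fun h => by simp [h] at hs
  rw [Psi4_brinkmann hA rfl (by simp [interpTetrad, div_eq_mul_inv])]
  simp [interpTetrad]
  field_simp
  simp

lemma Psi4_boost_interpTetrad {A : ℝ → ℂ} {p : Pt} (hA : ContDiffAt ℝ 2 A (p 0))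
    (w : Fin 4 → ℝ) :
    Psi4 (brinkmann A) p ((interpTetrad w).boost (Real.sqrt 2))
      = ((w 0 ^ 2 : ℝ) : ℂ) * A (p 0) := by
  have hs := sqrt_two_sq
  have hs0 : ((Real.sqrt 2 : ℝ) : ℂ) ≠ 0 := fun h => by simp [h] at hs
  rw [Psi4_brinkmann hA rfl (by simp [interpTetrad, Tetrad.boost, div_eq_mul_inv])]
  simp [interpTetrad, Tetrad.boost]
  field_simp
  left
  linear_combination -(w 0 : ℂ) ^ 2 * hs

/-! ### Polarization -/

lemma exp_four_mul (G : ℝ) :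
    Complex.exp (4 * (Complex.I * (G : ℂ)))
      = (Real.cos (4 * G) : ℂ) + (Real.sin (4 * G) : ℂ) * Complex.I := by
  rw [Complex.ofReal_cos, Complex.ofReal_sin, ← Complex.exp_mul_I]
  congr 1
  push_cast
  ring

lemma ampPlus_eq (Ψ : ℂ) : ampPlus Ψ = Ψ.re / 2 := by
  simp [ampPlus]; ring

lemma ampCross_eq (Ψ : ℂ) : ampCross Ψ = Ψ.im / 2 := by
  simp [ampCross, Complex.mul_re]; ring

lemma ampPlus_real_mul_exp (r G : ℝ) :
    ampPlus (((2 * r : ℝ) : ℂ) * Complex.exp (4 * (Complex.I * (G : ℂ))))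
      = r * Real.cos (4 * G) := by
  rw [ampPlus_eq, exp_four_mul, Complex.re_ofReal_mul]
  simp only [Complex.add_re, Complex.ofReal_re, Complex.re_ofReal_mul, Complex.I_re]
  ring

lemma ampCross_real_mul_exp (r G : ℝ) :
    ampCross (((2 * r : ℝ) : ℂ) * Complex.exp (4 * (Complex.I * (G : ℂ))))
      = r * Real.sin (4 * G) := by
  rw [ampCross_eq, exp_four_mul, Complex.im_ofReal_mul]
  simp only [Complex.add_im, Complex.ofReal_im, Complex.im_ofReal_mul, Complex.I_im]
  ring

/-- Two continuous functions on a preconnected set that differ by multiples of `π / 2`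
differ by a constant. -/
lemma sub_eq_sub_of_sin_eq_zero {J : Set ℝ} (hJ : IsPreconnected J) {P Q : ℝ → ℝ}
    (hP : ContinuousOn P J) (hQ : ContinuousOn Q J)
    (h : ∀ τ ∈ J, Real.sin (2 * Q τ - 2 * P τ) = 0) {τ₀ τ : ℝ} (hτ₀ : τ₀ ∈ J) (hτ : τ ∈ J) :
    P τ - P τ₀ = Q τ - Q τ₀ := by
  have hm : Set.MapsTo (fun τ => 2 * Q τ - 2 * P τ) J
      (AddSubgroup.zmultiples Real.pi : Set ℝ) := fun τ hτ => by
    obtain ⟨n, hn⟩ := Real.sin_eq_zero_iff.1 (h τ hτ)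
    exact ⟨n, by simpa using hn⟩
  have : DiscreteTopology (AddSubgroup.zmultiples Real.pi : Set ℝ) :=
    inferInstanceAs (DiscreteTopology (AddSubgroup.zmultiples Real.pi))
  have : 2 * Q τ - 2 * P τ = 2 * Q τ₀ - 2 * P τ₀ := hJ.constant_of_mapsTo ⟨this⟩
    ((continuousOn_const.mul hQ).sub (continuousOn_const.mul hP)) hm hτ hτ₀
  linarith

lemma hasDerivAt_arctan_tan {f : ℝ → ℝ} {f' t : ℝ} (hf : HasDerivAt f f' t)
    (hc : Real.cos (f t) ≠ 0) :
    HasDerivAt (fun s => Real.arctan (Real.tan (f s))) f' t := by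
  have h1 : HasDerivAt (fun s => Real.tan (f s)) (1 / Real.cos (f t) ^ 2 * f') t :=
    (Real.hasDerivAt_tan hc).comp t hf
  refine h1.arctan.congr_deriv ?_
  have := Real.inv_one_add_tan_sq hc
  rw [one_div (1 + _), this]
  field_simp

end PlaneWaves

end

open PlaneWaves
open scoped ContDiff ComplexConjugate

theorem proposition5 (M : PlaneWave) (T : Pt → Tetrad) (hT : M.IsCanonical T)
    (hγ : ∀ p ∈ M.U, conj (spinGamma M.g T p) = -spinGamma M.g T p) :
    ∃ (N : PlaneWave) (Φ : Pt → Pt) (S : Pt → Tetrad) (g G : ℝ → ℝ),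
      -- a change of coordinates to another Brinkmann form of the same plane wave
      IsCoordChange M.g M.U N.g N.U Φ ∧
      -- in which the invariant is `γ_c = i g(u)` with `g` real, in every canonical coframe
      ContDiffOn ℝ ∞ g N.uRange ∧
      (∀ p ∈ M.U, spinGamma M.g T p = Complex.I * (g (Φ p 0) : ℂ)) ∧
      N.IsCanonical S ∧
      (∀ S' : Pt → Tetrad, N.IsCanonical S' →
        ∀ q ∈ N.U, spinGamma N.g S' q = Complex.I * (g (q 0) : ℂ)) ∧
      -- and `A(u) = exp (4 ∫ γ_c du)`
      (∀ u ∈ N.uRange, HasDerivAt G (g u) u) ∧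
      (∀ u ∈ N.uRange, N.A u = Complex.exp (4 * (Complex.I * (G u : ℂ)))) ∧
      -- along every timelike geodesic
      ∀ (J : Set ℝ) (x : ℝ → Pt), IsOpen J → IsPreconnected J →
        IsTimelikeGeodesic N.g N.U x J →
        -- the magnitude, in the interpretation tetrad and after the constant boost by `√2`
        (∀ τ ∈ J, deriv x τ 0 ≠ 0 ∧
          IsNullTetrad N.g (x τ) (interpTetrad (deriv x τ)) ∧
          ‖N.psi4Along x τ‖ / (deriv x τ 0) ^ 2 = 2 ∧
          ‖Psi4 N.g (x τ) ((interpTetrad (deriv x τ)).boost (Real.sqrt 2))‖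
            / (deriv x τ 0) ^ 2 = 1) ∧
        -- the polarization phase where `A₊ ≠ 0`
        (∀ τ ∈ J, ampPlus (N.psi4Along x τ) ≠ 0 →
          polPhase (N.psi4Along x τ) = (1 / 2) * Real.arctan (Real.tan (4 * G (x τ 0))) ∧
          HasDerivAt (fun s => polPhase (N.psi4Along x s))
            (2 * g (x τ 0) * deriv x τ 0) τ) ∧
        -- the continuous polarization phase on the whole geodesic
        IsPolPhaseOn (N.psi4Along x) J (fun τ => 2 * G (x τ 0)) ∧
        ∀ P : ℝ → ℝ, IsPolPhaseOn (N.psi4Along x) J P → ∀ τ₀ ∈ J, ∀ τ ∈ J,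
          P τ - P τ₀ = 2 * ∫ s in τ₀..τ, g (x s 0) * deriv x s 0 ∧
          ((P τ - P τ₀ : ℝ) : ℂ) =
            ∫ s in τ₀..τ, -2 * Complex.I * spinGamma N.g S (x s) * (deriv x s 0 : ℂ) := by
  obtain ⟨u₀, hu₀⟩ : M.uRange.Nonempty := M.connected.nonempty.image _
  have hpos : 0 < ‖M.A u₀‖ := norm_pos_iff.2 (M.ne_zero _ hu₀)
  set k : ℝ := Real.sqrt ‖M.A u₀‖ with hk
  have hkpos : 0 < k := Real.sqrt_pos.2 hpos
  have hk2 : k ^ 2 = ‖M.A u₀‖ := Real.sq_sqrt hpos.le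
  have hkC : (k : ℂ) ≠ 0 := by exact_mod_cast hkpos.ne'
  set N : PlaneWave := M.rescale k hkpos.ne' with hN
  have hNA : N.A = fun s => M.A (k⁻¹ * s) / (k : ℂ) ^ 2 := rfl
  have hunit : ∀ u ∈ N.uRange, ‖N.A u‖ = 1 := by
    intro u hu
    have h := hT.norm_eq hγ (PlaneWave.rescale_mem hu) hu₀
    simp only [hNA, norm_div, norm_pow, Complex.norm_real, Real.norm_of_nonneg hkpos.le, h, hk2]
    exact div_self hpos.ne'
  obtain ⟨g, G, hg, hG, hexp, hdA⟩ := N.exists_phase hunit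
  have hchange := M.isCoordChange_scale hkpos.ne'
  have hGs : ContDiffOn ℝ ∞ G N.uRange :=
    (contDiffOn_infty_iff_deriv_of_isOpen N.uRange_isOpen).2
      ⟨fun u hu => (hG u hu).differentiableAt.differentiableWithinAt,
        hg.congr fun u hu => (hG u hu).deriv⟩
  have hcan : ∀ S' : Pt → Tetrad, N.IsCanonical S' →
      ∀ q ∈ N.U, spinGamma N.g S' q = Complex.I * (g (q 0) : ℂ) := by
    intro S' hS' q hq
    have hu := N.mem_uRange hq
    have hne : N.A (q 0) ≠ 0 := N.ne_zero _ hu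
    rw [hS'.spinGamma_eq hq, hunit _ hu, hdA _ hu]
    simp only [Real.sqrt_one, Complex.ofReal_one]
    field_simp
  have hS := N.isCanonical_phaseTetrad hGs hexp
  refine ⟨N, scale k, phaseTetrad N.A G, g, G, hchange, hg, ?_, hS, hcan, hG, hexp, ?_⟩
  · intro p hp
    have hu : p 0 ∈ M.uRange := M.mem_uRange hp
    have hne : M.A (p 0) ≠ 0 := M.ne_zero _ hu
    have h0 : scale k p 0 = k * p 0 := by simp [scale_apply]
    have hv : k * p 0 ∈ N.uRange := h0 ▸ N.mem_uRange (hchange.2.1 hp)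
    have hkp : k⁻¹ * (k * p 0) = p 0 := inv_mul_cancel_left₀ hkpos.ne' _
    have hd : HasDerivAt N.A (deriv M.A (p 0) * (k : ℂ)⁻¹ / (k : ℂ) ^ 2) (k * p 0) := by
      have h1 : HasDerivAt (fun s : ℝ => k⁻¹ * s) (k⁻¹) (k * p 0) := by
        simpa using (hasDerivAt_id (k * p 0)).const_mul k⁻¹
      have h2 : HasDerivAt M.A (deriv M.A (p 0)) (k⁻¹ * (k * p 0)) := by
        rw [hkp]; exact M.hasDerivAt hu
      refine ((h2.scomp _ h1).div_const _).congr_deriv ?_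
      rw [Complex.real_smul]
      push_cast
      ring
    have h4 := hdA _ hv
    rw [hd.deriv, hNA] at h4
    simp only [hkp] at h4
    rw [hT.spinGamma_eq hp, h0, hT.norm_eq hγ hu hu₀, ← hk]
    field_simp at h4 ⊢
    linear_combination h4
  intro J x hJ hJc hx
  obtain ⟨hx2, hxU, hxt, -⟩ := hx
  have hxu : ∀ τ ∈ J, x τ 0 ∈ N.uRange := fun τ hτ => N.mem_uRange (hxU τ hτ)
  have hint : ∀ τ ∈ J, deriv x τ 0 ≠ 0 ∧ IsNullTetrad N.g (x τ) (interpTetrad (deriv x τ)) :=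
    fun τ hτ => isNullTetrad_interpTetrad (hxt τ hτ)
  have hΨ : ∀ τ ∈ J, N.psi4Along x τ = ((2 * deriv x τ 0 ^ 2 : ℝ) : ℂ) * N.A (x τ 0) :=
    fun τ hτ => Psi4_interpTetrad (N.contDiffAt_two (hxu τ hτ)) _
  have hplus : ∀ τ ∈ J, ampPlus (N.psi4Along x τ)
      = deriv x τ 0 ^ 2 * Real.cos (4 * G (x τ 0)) := fun τ hτ => by
    rw [hΨ τ hτ, hexp _ (hxu τ hτ), ampPlus_real_mul_exp]
  have hcross : ∀ τ ∈ J, ampCross (N.psi4Along x τ)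
      = deriv x τ 0 ^ 2 * Real.sin (4 * G (x τ 0)) := fun τ hτ => by
    rw [hΨ τ hτ, hexp _ (hxu τ hτ), ampCross_real_mul_exp]
  have hpol : ∀ τ ∈ J, polPhase (N.psi4Along x τ)
      = (1 / 2) * Real.arctan (Real.tan (4 * G (x τ 0))) := fun τ hτ => by
    rw [polPhase, hplus τ hτ, hcross τ hτ,
      mul_div_mul_left _ _ (pow_ne_zero 2 (hint τ hτ).1), Real.tan_eq_sin_div_cos]
  have hxd : ∀ τ ∈ J, HasDerivAt (fun s => x s 0) (deriv x τ 0) τ := fun τ hτ =>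
    hasDerivAt_pi.1 (((hx2.contDiffAt (hJ.mem_nhds hτ)).differentiableAt (by simp)).hasDerivAt) 0
  have hGx : ∀ τ ∈ J, HasDerivAt (fun s => G (x s 0)) (g (x τ 0) * deriv x τ 0) τ :=
    fun τ hτ => (hG _ (hxu τ hτ)).comp τ (hxd τ hτ)
  have hGc : ContinuousOn (fun τ => 2 * G (x τ 0)) J := fun τ hτ =>
    ((hGx τ hτ).const_mul 2).continuousAt.continuousWithinAt
  have hcont : ContinuousOn (fun s => g (x s 0) * deriv x s 0) J := by
    have h1 : ContinuousOn (fun s => x s 0) J := fun s hs =>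
      (hxd s hs).continuousAt.continuousWithinAt
    have h2 : ContinuousOn (deriv x) J := hx2.continuousOn_deriv_of_isOpen hJ (by norm_num)
    exact (hg.continuousOn.comp h1 hxu).mul ((continuous_apply 0).comp_continuousOn h2)
  refine ⟨fun τ hτ => ⟨(hint τ hτ).1, (hint τ hτ).2, ?_, ?_⟩, fun τ hτ hne => ⟨hpol τ hτ, ?_⟩,
    ⟨hGc, fun τ hτ => ?_⟩, ?_⟩
  · rw [hΨ τ hτ, norm_mul, hunit _ (hxu τ hτ), Complex.norm_real,
      Real.norm_of_nonneg (by positivity), mul_one]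
    exact mul_div_cancel_right₀ _ (pow_ne_zero 2 (hint τ hτ).1)
  · have h := Psi4_boost_interpTetrad (N.contDiffAt_two (hxu τ hτ)) (deriv x τ)
    rw [PlaneWave.g, h, norm_mul, hunit _ (hxu τ hτ), Complex.norm_real,
      Real.norm_of_nonneg (by positivity), mul_one]
    exact div_self (pow_ne_zero 2 (hint τ hτ).1)
  · have hc : Real.cos (4 * G (x τ 0)) ≠ 0 := by
      rw [hplus τ hτ] at hne
      exact right_ne_zero_of_mul hne
    have hd := (hasDerivAt_arctan_tan ((hGx τ hτ).const_mul 4) hc).const_mul (1 / 2)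
    refine (hd.congr_of_eventuallyEq ?_).congr_deriv (by ring)
    filter_upwards [hJ.mem_nhds hτ] with s hs using hpol s hs
  · rw [hplus τ hτ, hcross τ hτ, show 2 * (2 * G (x τ 0)) = 4 * G (x τ 0) by ring]
    ring
  · intro P hP τ₀ hτ₀ τ hτ
    have hsub : Set.uIcc τ₀ τ ⊆ J := hJc.ordConnected.uIcc_subset hτ₀ hτ
    have hsin : ∀ s ∈ J, Real.sin (2 * (2 * G (x s 0)) - 2 * P s) = 0 := by
      intro s hs
      have h := hP.2 s hs
      rw [hplus s hs, hcross s hs, mul_assoc, mul_assoc] at h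
      have h' := mul_left_cancel₀ (pow_ne_zero 2 (hint s hs).1) h
      rw [show 2 * (2 * G (x s 0)) = 4 * G (x s 0) by ring, Real.sin_sub]
      linarith
    have hdiff := sub_eq_sub_of_sin_eq_zero hJc hP.1 hGc hsin hτ₀ hτ
    have hftc := intervalIntegral.integral_eq_sub_of_hasDerivAt
      (fun s hs => hGx s (hsub hs)) (hcont.mono hsub).intervalIntegrable
    have hreal : P τ - P τ₀ = 2 * ∫ s in τ₀..τ, g (x s 0) * deriv x s 0 := by
      rw [hftc, hdiff]; ring
    refine ⟨hreal, ?_⟩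
    have hcongr : (∫ s in τ₀..τ, -2 * Complex.I * spinGamma N.g (phaseTetrad N.A G) (x s)
        * (deriv x s 0 : ℂ)) = ∫ s in τ₀..τ, ((2 * (g (x s 0) * deriv x s 0) : ℝ) : ℂ) := by
      refine intervalIntegral.integral_congr fun s hs => ?_
      simp only [hcan _ hS _ (hxU s (hsub hs))]
      push_cast
      linear_combination (-2 * (g (x s 0) : ℂ) * (deriv x s 0 : ℂ)) * Complex.I_sq
    rw [hcongr, intervalIntegral.integral_ofReal, intervalIntegral.integral_const_mul, hreal]
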